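/- A gyrogroup is a set $G$ with a binary operation $\oplus$ that has a (unique) two-sided identity $0$ and, for each $x\in G$, a (unique) two-sided inverse $\ominus x$, such that for all $x,y\in G$ there is an automorphism $\mathrm{gyr}[x,y]$ of $(G,\oplus)$ with $$x\oplus(y\oplus z)=(x\oplus y)\oplus \mathrm{gyr}[x,y](z)\quad\text{for all } z\in G,$$ and $\mathrm{gyr}[x\oplus y,y]=\mathrm{gyr}[x,y]$. A topological gyrogroup is a gyrogroup $G$ with a $T_1$ topology for which $\oplus: G\times G\to G$ is (jointly) continuous and $\ominus: G\to G$ is continuous. It is strongly topological if there is a neighbourhood base $\mathscr U$ at $0$ with $\mathrm{gyr}[x,y](U)=U$ for all $U\in\mathscr U$ and all $x,y\in G$. A base for $G$ at a set $K\subseteq G$ is a family of open sets containing $K$ such that every open set containing $K$ contains a member of the family; $G$ is feathered if it contains a nonempty compact set $K$ that has a countable base in $G$ (that is, $K$ has countable character in $G$). Every feathered strongly topological gyrogroup $G$ is paracompact: every open cover of $G$ has a locally finite open refinement covering $G$. -/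

import Mathlib

open Topology

/-- A gyrogroup, written additively: a set with a binary operation `+`, a two-sided identity `0`,
two-sided inverses `-x`, and, for all `x y`, an automorphism `gyr x y` of the groupoid `(G, +)`
satisfying the left gyroassociative law and the left loop property. No associativity or
commutativity of `+` is assumed. The uniqueness of the identity, of inverses and of the gyrations
follows from these laws, see `Gyrogroup.zero_unique`, `Gyrogroup.neg_unique` and
`Gyrogroup.gyr_unique`. -/
class Gyrogroup (G : Type*) extends AddZeroClass G, Neg G where
  neg_add_self' : ∀ x : G, -x + x = 0
  add_neg_self' : ∀ x : G, x + -x = 0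
  /-- the gyration generated by `x` and `y` -/
  gyr : G → G → (G ≃+ G)
  gyr_assoc : ∀ x y z : G, x + (y + z) = (x + y) + gyr x y z
  gyr_loop : ∀ x y : G, gyr (x + y) y = gyr x y

namespace Gyrogroup

variable {G : Type*} [Gyrogroup G]

theorem left_cancel {x a b : G} (h : x + a = x + b) : a = b := by
  have key : ∀ z : G, -x + (x + z) = gyr (-x) x z := fun z => by
    rw [gyr_assoc, neg_add_self', zero_add]
  have h' : gyr (-x) x a = gyr (-x) x b := by rw [← key, ← key, h]
  exact (gyr (-x) x).injective h'

theorem zero_unique {e : G} (he : ∀ a : G, e + a = a ∧ a + e = a) : e = 0 := by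
  have h := (he 0).1
  rwa [add_zero] at h

theorem neg_unique {x y : G} (h : x + y = 0) : y = -x :=
  left_cancel (h.trans (add_neg_self' x).symm)

theorem gyr_unique {x y : G} {f : G → G} (hf : ∀ z, x + (y + z) = (x + y) + f z) :
    f = gyr x y :=
  funext fun z => left_cancel ((hf z).symm.trans (gyr_assoc x y z))

end Gyrogroup

/-- A topological gyrogroup: the operation is jointly continuous and inversion is continuous. -/
class TopologicalGyrogroup (G : Type*) [TopologicalSpace G] [Gyrogroup G] : Prop
    extends ContinuousAdd G, ContinuousNeg G

/-- A strongly topological gyrogroup: a topological gyrogroup with a neighbourhood base `𝒰` at `0`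
all of whose members are invariant under every gyration. -/
class StronglyTopologicalGyrogroup (G : Type*) [TopologicalSpace G] [Gyrogroup G] : Prop
    extends TopologicalGyrogroup G where
  exists_invariant_base : ∃ 𝒰 : Set (Set G),
    (∀ U ∈ 𝒰, U ∈ 𝓝 (0 : G)) ∧ (∀ V ∈ 𝓝 (0 : G), ∃ U ∈ 𝒰, U ⊆ V) ∧
      ∀ U ∈ 𝒰, ∀ x y : G, Gyrogroup.gyr x y '' U = U

/-- `γ` is a base for the space `X` at the set `F`. -/
def IsBaseAtSet {X : Type*} [TopologicalSpace X] (γ : Set (Set X)) (F : Set X) : Prop :=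
  (∀ U ∈ γ, IsOpen U ∧ F ⊆ U) ∧ ∀ V : Set X, IsOpen V → F ⊆ V → ∃ U ∈ γ, U ⊆ V

/-- The character of `X` at `F`: the smallest cardinality of a base for `X` at `F`. -/
noncomputable def characterAtSet {X : Type*} [TopologicalSpace X] (F : Set X) : Cardinal :=
  sInf {κ : Cardinal | ∃ γ : Set (Set X), IsBaseAtSet γ F ∧ Cardinal.mk γ = κ}

theorem characterAtSet_le_aleph0_iff {X : Type*} [TopologicalSpace X] (F : Set X) :
    characterAtSet F ≤ Cardinal.aleph0 ↔ ∃ γ : Set (Set X), γ.Countable ∧ IsBaseAtSet γ F := by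
  constructor
  · intro h
    have hne : {κ : Cardinal | ∃ γ : Set (Set X), IsBaseAtSet γ F ∧ Cardinal.mk γ = κ}.Nonempty :=
      ⟨_, {U | IsOpen U ∧ F ⊆ U}, ⟨fun _ hU => hU, fun V hV hF => ⟨V, ⟨hV, hF⟩, subset_rfl⟩⟩, rfl⟩
    obtain ⟨γ, hγ, hc⟩ := csInf_mem hne
    refine ⟨γ, ?_, hγ⟩
    rw [← Cardinal.le_aleph0_iff_set_countable, hc]
    exact h
  · rintro ⟨γ, hc, hγ⟩
    have hle : characterAtSet F ≤ Cardinal.mk γ :=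
      csInf_le (OrderBot.bddBelow _) ⟨γ, hγ, rfl⟩
    exact hle.trans (Cardinal.le_aleph0_iff_set_countable.2 hc)

/-- A space (in particular a topological gyrogroup) is feathered in the sense used here if it
contains a nonempty compact set of countable character. -/
def IsFeathered (X : Type*) [TopologicalSpace X] : Prop :=
  ∃ K : Set X, K.Nonempty ∧ IsCompact K ∧ characterAtSet K ≤ Cardinal.aleph0

/-! Move the compact set by a left translation so that it contains 0, and choose gyration-invariant
neighbourhoods `U n` of 0, each halving the previous one, inside its countable base. The relations
`-x + y ∈ U n` generate a pseudometrizable, hence paracompact, topology coarser than that of `G`. By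
compactness the `U n` form a base at the compact set `H = ⋂ n, U n`, so coarse neighbourhoods of `x`
shrink to `x + H`. Finite subcovers over these compact sets then pull paracompactness back along the
identity map. -/

open Set Filter

/-- A space that maps continuously to a paracompact space, such that the preimages of the
neighbourhoods of each point of the image shrink to a compact set, is paracompact. -/
theorem ParacompactSpace.of_comap_nhds_le_nhdsSet {X Y : Type*} [TopologicalSpace X]
    [TopologicalSpace Y] [ParacompactSpace Y] {f : X → Y} (hf : Continuous f)
    (hsurj : f.Surjective)
    (h : ∀ x, ∃ C : Set X, IsCompact C ∧ comap f (𝓝 (f x)) ≤ 𝓝ˢ C) : ParacompactSpace X := by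
  refine ⟨fun α s hs hcov => ?_⟩
  have key : ∀ x : X, ∃ (t : Finset α) (N : Set Y),
      IsOpen N ∧ f x ∈ N ∧ f ⁻¹' N ⊆ ⋃ i ∈ t, s i := by
    intro x
    obtain ⟨C, hC, hle⟩ := h x
    obtain ⟨t, ht⟩ := hC.elim_finite_subcover s hs (hcov ▸ subset_univ C)
    have hO : (⋃ i ∈ t, s i) ∈ 𝓝ˢ C :=
      (isOpen_biUnion fun i _ => hs i).mem_nhdsSet.2 ht
    obtain ⟨M, hM, hMs⟩ := mem_comap.1 (hle hO)
    obtain ⟨N, hNM, hN, hxN⟩ := mem_nhds_iff.1 hM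
    exact ⟨t, N, hN, hxN, (preimage_mono hNM).trans hMs⟩
  choose t N hN hxN hsub using key
  obtain ⟨v, hvo, hvc, hvf, hvN⟩ := precise_refinement N hN
    (eq_univ_of_forall fun y => by
      obtain ⟨x, rfl⟩ := hsurj y
      exact mem_iUnion.2 ⟨x, hxN x⟩)
  -- Each `t x` is finite, so cutting `f ⁻¹' v x` into these pieces keeps local finiteness.
  refine ⟨Σ x : X, t x, fun b => f ⁻¹' v b.1 ∩ s b.2, fun b => ((hvo _).preimage hf).inter (hs _),
    eq_univ_of_forall fun z => ?_, fun z => ?_, fun b => ⟨b.2, inter_subset_right⟩⟩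
  · obtain ⟨x, hx⟩ := mem_iUnion.1 (hvc ▸ mem_univ (f z))
    obtain ⟨i, hi, hzi⟩ := mem_iUnion₂.1 (hsub x (hvN x hx))
    exact mem_iUnion.2 ⟨⟨x, ⟨i, hi⟩⟩, hx, hzi⟩
  · obtain ⟨M, hM, hfin⟩ := hvf (f z)
    refine ⟨f ⁻¹' M, hf.continuousAt hM, ?_⟩
    refine (hfin.biUnion fun x _ => finite_range (Sigma.mk (β := fun x => t x) x)).subset ?_
    rintro ⟨x, i⟩ ⟨w, ⟨hw, -⟩, hwM⟩
    exact mem_iUnion₂.2 ⟨x, ⟨f w, hw, hwM⟩, i, rfl⟩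

/-- A decreasing sequence of entourages generates a paracompact topology. -/
theorem exists_paracompactSpace_of_entourages {X : Type*} (E : ℕ → Set (X × X))
    (hanti : Antitone E) (hrefl : ∀ n x, (x, x) ∈ E n)
    (hsymm : ∀ n x y, (x, y) ∈ E (n + 1) → (y, x) ∈ E n)
    (hcomp : ∀ n x y z, (x, y) ∈ E (n + 1) → (y, z) ∈ E (n + 1) → (x, z) ∈ E n) :
    ∃ τ : TopologicalSpace X, @ParacompactSpace X τ ∧
      ∀ x, (@nhds X τ x).HasBasis (fun _ => True) fun n => {y | (x, y) ∈ E n} := by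
  let B : FilterBasis (X × X) :=
    { sets := range E
      nonempty := range_nonempty E
      inter_sets := by
        rintro _ _ ⟨m, rfl⟩ ⟨n, rfl⟩
        exact ⟨_, ⟨max m n, rfl⟩,
          subset_inter (hanti (le_max_left m n)) (hanti (le_max_right m n))⟩ }
  let u : UniformSpace X := .ofCore (.mkOfBasis B
    (by rintro _ ⟨n, rfl⟩ x; exact hrefl n x)
    (by rintro _ ⟨n, rfl⟩; exact ⟨_, ⟨n + 1, rfl⟩, fun p hp => hsymm n _ _ hp⟩)
    (by
      rintro _ ⟨n, rfl⟩
      refine ⟨_, ⟨n + 1, rfl⟩, ?_⟩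
      rintro ⟨x, z⟩ ⟨y, hxy, hyz⟩
      exact hcomp n x y z hxy hyz))
  have hb : (uniformity X).HasBasis (fun _ : ℕ => True) E := by
    refine ⟨fun s => (B.mem_filter_iff).trans ?_⟩
    constructor
    · rintro ⟨_, ⟨n, rfl⟩, h⟩
      exact ⟨n, trivial, h⟩
    · rintro ⟨n, -, h⟩
      exact ⟨_, ⟨n, rfl⟩, h⟩
  have : (uniformity X).IsCountablyGenerated := hb.isCountablyGenerated
  refine ⟨u.toTopologicalSpace, ?_, fun x => nhds_basis_uniformity' hb⟩
  -- No separation is needed: pseudometric spaces are already paracompact.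
  let := UniformSpace.pseudoMetricSpace X
  exact inferInstance

namespace Gyrogroup

variable {G : Type*} [Gyrogroup G]

theorem gyr_zero_left (x z : G) : gyr 0 x z = z := by
  refine left_cancel (x := 0 + x) ?_
  rw [← gyr_assoc, zero_add, zero_add]

theorem gyr_neg_self (x z : G) : gyr (-x) x z = z := by
  rw [← gyr_loop, neg_add_self', gyr_zero_left]

theorem neg_add_cancel_left' (x z : G) : -x + (x + z) = z := by
  rw [gyr_assoc, neg_add_self', zero_add, gyr_neg_self]

theorem neg_neg' (x : G) : - -x = x :=
  (neg_unique (neg_add_self' x)).symm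

theorem add_neg_cancel_left' (x z : G) : x + (-x + z) = z := by
  simpa only [neg_neg'] using neg_add_cancel_left' (-x) z

/-- Replaces telescoping in a group; the gyration is harmless for invariant sets, so the relations
compose. -/
theorem neg_add_add_gyr (x y z : G) : (-x + y) + gyr (-x) y (-y + z) = -x + z := by
  rw [← gyr_assoc, add_neg_cancel_left']

/-- Gives symmetry of the relations, again up to a gyration. -/
theorem gyr_neg_add (x y : G) : gyr (-x) y (-y + x) = -(-x + y) :=
  neg_unique (by rw [neg_add_add_gyr, neg_add_self'])

/-- Left translation by `x`, as a homeomorphism. -/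
def addLeftHomeomorph [TopologicalSpace G] [ContinuousAdd G] (x : G) : G ≃ₜ G where
  toFun z := x + z
  invFun z := -x + z
  left_inv := neg_add_cancel_left' x
  right_inv := add_neg_cancel_left' x
  continuous_toFun := continuous_const.add continuous_id
  continuous_invFun := continuous_const.add continuous_id

theorem mem_iff_gyr_mem {U : Set G} (hU : ∀ x y : G, gyr x y '' U = U) (x y : G) {z : G} :
    gyr x y z ∈ U ↔ z ∈ U := by
  conv_lhs => rw [← hU x y]
  exact (gyr x y).injective.mem_set_image

end Gyrogroup

open Gyrogroup

/-- In a strongly topological gyrogroup, any sequence of neighbourhoods of `0` is refined by a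
sequence of gyration-invariant neighbourhoods, each of which halves the preceding one. -/
theorem exists_invariant_halving_seq {G : Type*} [TopologicalSpace G] [Gyrogroup G]
    [StronglyTopologicalGyrogroup G] (W : ℕ → Set G) (hW : ∀ n, W n ∈ 𝓝 0) :
    ∃ U : ℕ → Set G, (∀ n, U n ∈ 𝓝 0) ∧ (∀ n, U n ⊆ W n) ∧
      (∀ n x y, gyr x y '' U n = U n) ∧ (∀ n, ∀ a ∈ U (n + 1), -a ∈ U n) ∧
      ∀ n, ∀ a ∈ U (n + 1), ∀ b ∈ U (n + 1), a + b ∈ U n := by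
  obtain ⟨𝒰, hnhds, hbase, hinv⟩ :=
    StronglyTopologicalGyrogroup.exists_invariant_base (G := G)
  have step : ∀ (n : ℕ) (V : 𝒰), ∃ V' : 𝒰, V'.1 ⊆ W n ∧ (∀ a ∈ V'.1, -a ∈ V.1) ∧
      ∀ a ∈ V'.1, ∀ b ∈ V'.1, a + b ∈ V.1 := by
    intro n V
    have hneg : {a : G | -a ∈ V.1} ∈ 𝓝 (0 : G) := by
      refine continuous_neg.continuousAt.preimage_mem_nhds ?_
      rw [← neg_unique (zero_add (0 : G))]
      exact hnhds _ V.2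
    have hadd : {p : G × G | p.1 + p.2 ∈ V.1} ∈ 𝓝 ((0 : G), (0 : G)) := by
      refine continuous_add.continuousAt.preimage_mem_nhds ?_
      rw [zero_add]
      exact hnhds _ V.2
    rw [nhds_prod_eq, mem_prod_same_iff] at hadd
    obtain ⟨t, ht, hsub⟩ := hadd
    obtain ⟨V', hV', hle⟩ := hbase _ (inter_mem (inter_mem (hW n) hneg) ht)
    exact ⟨⟨V', hV'⟩, fun a ha => (hle ha).1.1, fun a ha => (hle ha).1.2,
      fun a ha b hb => @hsub (a, b) ⟨(hle ha).2, (hle hb).2⟩⟩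
  choose next h1 h2 h3 using step
  obtain ⟨V, hV, hVW⟩ := hbase _ (hW 0)
  let U : ℕ → 𝒰 := fun n => n.rec ⟨V, hV⟩ fun k ih => next (k + 1) ih
  exact ⟨fun n => (U n).1, fun n => hnhds _ (U n).2,
    fun n => by cases n with
      | zero => exact hVW
      | succ k => exact h1 (k + 1) (U k),
    fun n => hinv _ (U n).2, fun n => h2 (n + 1) (U n), fun n => h3 (n + 1) (U n)⟩

/-- A sequence form of countable character. -/
theorem exists_seq_isBaseAtSet {X : Type*} [TopologicalSpace X] {K : Set X}
    (hK : characterAtSet K ≤ Cardinal.aleph0) :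
    ∃ W : ℕ → Set X, IsBaseAtSet (range W) K := by
  obtain ⟨γ, hc, hγ⟩ := (characterAtSet_le_aleph0_iff K).1 hK
  obtain ⟨V, hV, -⟩ := hγ.2 univ isOpen_univ (subset_univ K)
  obtain ⟨W, rfl⟩ := hc.exists_eq_range ⟨V, hV⟩
  exact ⟨W, hγ⟩

/-- If a decreasing sequence of sets `F n`, each containing the closure of a later one, is
eventually inside every neighbourhood of the compact set `K`, then it is eventually inside every
neighbourhood of its intersection. -/
theorem exists_subset_of_iInter_subset {X : Type*} [TopologicalSpace X] {K : Set X}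
    (hK : IsCompact K) {F : ℕ → Set X} (hF : Antitone F)
    (hcl : ∀ n, ∃ m, closure (F m) ⊆ F n)
    (hFK : ∀ O : Set X, IsOpen O → K ⊆ O → ∃ n, F n ⊆ O) {O : Set X} (hO : IsOpen O)
    (h : ⋂ n, F n ⊆ O) : ∃ n, F n ⊆ O := by
  by_contra! hne
  -- A point of `K` in every closure would lie in `⋂ n, F n ⊆ O`, yet `O` misses `F 0 \ O`.
  have hcover : K ⊆ ⋃ n, (closure (F n \ O))ᶜ := by
    intro p _
    by_contra hp
    simp only [mem_iUnion, mem_compl_iff, not_exists, not_not] at hp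
    have hpF : p ∈ ⋂ n, F n := mem_iInter.2 fun n => by
      obtain ⟨m, hm⟩ := hcl n
      exact hm (closure_mono sdiff_subset (hp m))
    obtain ⟨q, hqO, hq⟩ := mem_closure_iff.1 (hp 0) O hO (h hpF)
    exact hq.2 hqO
  have hdir : Directed (· ⊆ ·) fun n => (closure (F n \ O))ᶜ :=
    Monotone.directed_le fun m n hmn =>
      compl_subset_compl.2 (closure_mono (sdiff_subset_sdiff_left (hF hmn)))
  obtain ⟨n, hn⟩ := hK.elim_directed_cover _ (fun n => isClosed_closure.isOpen_compl) hcover hdir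
  obtain ⟨m, hm⟩ := hFK _ isClosed_closure.isOpen_compl hn
  obtain ⟨x, hx, hxO⟩ := not_subset.1 (hne (max m n))
  exact hm (hF (le_max_left m n) hx) (subset_closure ⟨hF (le_max_right m n) hx, hxO⟩)

theorem mainTheorem1 (G : Type*) [TopologicalSpace G] [T1Space G] [Gyrogroup G]
    [StronglyTopologicalGyrogroup G] (hG : IsFeathered G) : ParacompactSpace G := by
  obtain ⟨K, ⟨k, hk⟩, hKc, hchar⟩ := hG
  obtain ⟨W, hWo, hWb⟩ := exists_seq_isBaseAtSet hchar
  -- Translate `K` and its base so that `K` contains `0`.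
  let L := addLeftHomeomorph k
  have hLK : IsCompact (L ⁻¹' K) := L.isCompact_preimage.2 hKc
  have hLb : ∀ O : Set G, IsOpen O → L ⁻¹' K ⊆ O → ∃ n, L ⁻¹' W n ⊆ O := by
    intro O hO hsub
    obtain ⟨_, ⟨n, rfl⟩, hn⟩ := hWb (L '' O) (L.isOpenMap O hO) fun z hz =>
      ⟨L.symm z, hsub (by simpa using hz), L.apply_symm_apply z⟩
    refine ⟨n, fun z hz => ?_⟩
    obtain ⟨w, hw, hwz⟩ := hn hz
    exact L.injective hwz ▸ hw
  obtain ⟨U, hU, hUW, hinv, hneg, hadd⟩ := exists_invariant_halving_seq (fun n => L ⁻¹' W n)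
    fun n => ((hWo _ ⟨n, rfl⟩).1.preimage L.continuous).mem_nhds
      ((hWo _ ⟨n, rfl⟩).2 (by simpa [L, addLeftHomeomorph] using hk))
  have hU0 : ∀ n, (0 : G) ∈ U n := fun n => mem_of_mem_nhds (hU n)
  have hUanti : Antitone U := antitone_nat_of_succ_le fun n a ha => by
    simpa using hadd n a ha 0 (hU0 _)
  let E : ℕ → Set (G × G) := fun n => {p | -p.1 + p.2 ∈ U n}
  have hcomp : ∀ n x y z, (x, y) ∈ E (n + 1) → (y, z) ∈ E (n + 1) → (x, z) ∈ E n := by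
    intro n x y z hxy hyz
    change -x + z ∈ U n
    rw [← neg_add_add_gyr x y z]
    exact hadd n _ hxy _ ((mem_iff_gyr_mem (hinv _) _ _).2 hyz)
  have hsymm : ∀ n x y, (x, y) ∈ E (n + 1) → (y, x) ∈ E n := by
    intro n x y hxy
    refine (mem_iff_gyr_mem (hinv n) (-x) y).1 ?_
    rw [gyr_neg_add]
    exact hneg n _ hxy
  have hEnhds : ∀ n x, {y | (x, y) ∈ E n} ∈ 𝓝 x := by
    intro n x
    refine (addLeftHomeomorph (-x)).continuous.continuousAt.preimage_mem_nhds (t := U n) ?_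
    rw [show addLeftHomeomorph (-x) x = 0 from neg_add_self' x]
    exact hU n
  have hEzero : ∀ n x, (0, x) ∈ E n ↔ x ∈ U n := by
    intro n x
    change -0 + x ∈ U n ↔ _
    rw [← neg_unique (zero_add (0 : G)), zero_add]
  -- One index is spent on symmetry, one on composition.
  have hUcl : ∀ n, closure (U (n + 2)) ⊆ U n := by
    intro n p hp
    obtain ⟨y, hy, hyU⟩ := mem_closure_iff_nhds.1 hp _ (hEnhds (n + 2) p)
    rw [← hEzero]
    refine hcomp n 0 y p ((hEzero _ _).2 (hUanti (Nat.le_succ _) hyU)) (hsymm _ _ _ hy)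
  have hsubK : ⋂ n, U n ⊆ L ⁻¹' K := by
    intro x hx
    by_contra hxK
    -- Points are closed by `T1Space`.
    obtain ⟨n, hn⟩ := hLb {x}ᶜ isOpen_compl_singleton (subset_compl_singleton_iff.2 hxK)
    exact hn (hUW n (mem_iInter.1 hx n)) rfl
  have hclosed : IsClosed (⋂ n, U n) :=
    isClosed_of_closure_subset fun p hp => mem_iInter.2 fun n =>
      hUcl n (closure_mono (iInter_subset U (n + 2)) hp)
  have hcpt : IsCompact (⋂ n, U n) := hLK.of_isClosed_subset hclosed hsubK
  have hbase : ∀ O : Set G, IsOpen O → ⋂ n, U n ⊆ O → ∃ n, U n ⊆ O := fun O hO h =>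
    exists_subset_of_iInter_subset hLK hUanti (fun n => ⟨n + 2, hUcl n⟩)
      (fun O hO h => (hLb O hO h).imp fun n hn => (hUW n).trans hn) hO h
  have hfiber : ∀ x, ∃ C : Set G, IsCompact C ∧ ∀ s ∈ 𝓝ˢ C, ∃ n, {y | (x, y) ∈ E n} ⊆ s := by
    intro x
    -- The relation ball at `x` is `x + U n`, so the base at `H` translates to one at `x + H`.
    refine ⟨addLeftHomeomorph x '' ⋂ n, U n, hcpt.image (addLeftHomeomorph x).continuous, ?_⟩
    intro s hs
    obtain ⟨O, hO, hsub, hOs⟩ := mem_nhdsSet_iff_exists.1 hs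
    obtain ⟨n, hn⟩ := hbase _ (hO.preimage (addLeftHomeomorph x).continuous)
      (image_subset_iff.1 hsub)
    refine ⟨n, fun y hy => hOs ?_⟩
    have := hn hy
    rwa [mem_preimage, show addLeftHomeomorph x (-x + y) = y from add_neg_cancel_left' x y] at this
  let τG : TopologicalSpace G := inferInstance
  obtain ⟨τ, hτ, hτb⟩ := exists_paracompactSpace_of_entourages E
    (fun m n hmn p hp => hUanti hmn hp)
    (fun n x => by simpa only [E, mem_ofPred_eq, neg_add_self'] using hU0 n) hsymm hcomp
  refine @ParacompactSpace.of_comap_nhds_le_nhdsSet G G τG τ hτ id ?_ Function.surjective_id ?_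
  · refine (@continuous_iff_continuousAt G G τG τ id).2 fun x => ?_
    exact (hτb x).ge_iff.2 fun n _ => hEnhds n x
  · intro x
    obtain ⟨C, hC, hCs⟩ := hfiber x
    refine ⟨C, hC, ?_⟩
    rw [comap_id]
    exact fun s hs => (hτb x).mem_iff.2 ((hCs s hs).imp fun n hn => ⟨trivial, hn⟩)
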